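/- Let $k$ be an algebraically closed field of characteristic zero, let $f_1,\ldots,f_{n-1}\in k[[X_1,\ldots,X_n]]$, and suppose that $\mathcal O=k[[X_1,\ldots,X_n]]/\langle f_1,\ldots,f_{n-1}\rangle$ is reduced of Krull dimension one (a complete intersection algebroid curve). For a quotient $R=k[[X_1,\ldots,X_n]]/\mathfrak B$, let $$\Omega(R)=R^{\oplus n}\Big/\Big\langle \tfrac{\partial f}{\partial X_1}e_1+\cdots+\tfrac{\partial f}{\partial X_n}e_n\ ;\ f\in\mathfrak B\Big\rangle$$ be its $R$-module of Kähler differentials, where $e_1,\ldots,e_n$ is the canonical basis and $dx_l$ denotes the class of $e_l$; its torsion submodule is the set of $\omega\in\Omega(R)$ such that $h\omega=0$ for some non-zero-divisor $h\in R$. Let $\wp_1,\ldots,\wp_r$ be the minimal primes of $\mathcal O$, let $\mathcal O_i=\mathcal O/\wp_i$ with projection $\pi_i:\mathcal O\to\mathcal O_i$, and let $$\pi^*:\Omega(\mathcal O)\to\prod_{i=1}^r\Omega(\mathcal O_i),\qquad \sum_l g_l\,dx_l\mapsto\Big(\sum_l\pi_i(g_l)\,dx_l\Big)_{i=1,\ldots,r}.$$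 Let $\mathcal T$ and $\mathcal T_i$ be the torsion submodules of $\Omega(\mathcal O)$ (over $\mathcal O$) and of $\Omega(\mathcal O_i)$ (over $\mathcal O_i$), respectively. Then $$(\pi^*)^{-1}(\mathcal T_1\times\cdots\times\mathcal T_r)=\mathcal T.$$ -/

import Mathlib

namespace AlgebroidCurve

noncomputable section Differentials

variable {k : Type*} [Field k] {n : ℕ}

/-- Let `φ : k[[X₁, …, Xₙ]] → R` be a (surjective) ring homomorphism, presenting `R` as
`k[[X₁, …, Xₙ]] / 𝔄` with `𝔄 = ker φ`. This is the `R`-submodule of `Rⁿ` generated by the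
vectors `(∂f/∂X₁, …, ∂f/∂Xₙ)`, read in `R`, for `f ∈ 𝔄`. -/
def relations {R : Type*} [CommRing R] (φ : MvPowerSeries (Fin n) k →+* R) :
    Submodule R (Fin n → R) :=
  Submodule.span R
    {v | ∃ f ∈ RingHom.ker φ, v = fun i => φ (MvPowerSeries.pderiv k i f)}

/-- The module of Kähler differentials `Ω(R)` of `R = k[[X₁, …, Xₙ]] / 𝔄`, where `𝔄 = ker φ`:
the quotient of `Rⁿ` by the relations `f_{X₁} e₁ + ⋯ + f_{Xₙ} eₙ`, `f ∈ 𝔄`. -/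
abbrev Omega {R : Type*} [CommRing R] (φ : MvPowerSeries (Fin n) k →+* R) : Type _ :=
  (Fin n → R) ⧸ relations φ

/-- The torsion submodule of `Ω(R)`: the differentials killed by a non-zero-divisor of `R`. -/
abbrev torsionOmega {R : Type*} [CommRing R] (φ : MvPowerSeries (Fin n) k →+* R) :
    Submodule R (Omega φ) :=
  Submodule.torsion R (Omega φ)

/-- The composite `k[[X₁, …, Xₙ]] → R → R / p`, which presents `R / p`. -/
abbrev branchMap {R : Type*} [CommRing R] (φ : MvPowerSeries (Fin n) k →+* R) (p : Ideal R) :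
    MvPowerSeries (Fin n) k →+* R ⧸ p :=
  (Ideal.Quotient.mk p).comp φ

/-- The `R`-linear map `Rⁿ → Ω(R / p)`, `(g₁, …, gₙ) ↦ ∑ π(g_l) dx_l`. -/
def preBranch {R : Type*} [CommRing R] (φ : MvPowerSeries (Fin n) k →+* R) (p : Ideal R) :
    (Fin n → R) →ₗ[R] Omega (branchMap φ p) :=
  ((relations (branchMap φ p)).mkQ.restrictScalars R).comp
    ((Algebra.linearMap R (R ⧸ p)).compLeft (Fin n))

theorem relations_le_ker_preBranch {R : Type*} [CommRing R]
    (φ : MvPowerSeries (Fin n) k →+* R) (p : Ideal R) :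
    relations φ ≤ LinearMap.ker (preBranch φ p) := by
  refine Submodule.span_le.2 ?_
  rintro v ⟨f, hf, rfl⟩
  refine (Submodule.Quotient.mk_eq_zero _).2 (Submodule.subset_span ⟨f, ?_, rfl⟩)
  rw [RingHom.mem_ker] at hf ⊢
  rw [RingHom.comp_apply, hf, map_zero]

/-- The homomorphism `Ω(R) → Ω(R / p)`, `∑ g_l dx_l ↦ ∑ π(g_l) dx_l`, induced by the projection
`π : R → R / p`. -/
def toBranch {R : Type*} [CommRing R] (φ : MvPowerSeries (Fin n) k →+* R) (p : Ideal R) :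
    Omega φ →ₗ[R] Omega (branchMap φ p) :=
  (relations φ).liftQ (preBranch φ p) (relations_le_ker_preBranch φ p)

/-- The homomorphism `π* : Ω(R) → ∏ Ω(R / p)`, the product being over the minimal primes `p`
of `R`. -/
def piStar {R : Type*} [CommRing R] (φ : MvPowerSeries (Fin n) k →+* R) :
    Omega φ →ₗ[R] ((p : minimalPrimes R) → Omega (branchMap φ p.1)) :=
  LinearMap.pi fun p => toBranch φ p.1

/-- The product `∏ T_p` inside `∏ Ω(R / p)`, where `T_p` is the torsion submodule of the
`R / p`-module `Ω(R / p)`, and `p` ranges over the minimal primes of `R`. -/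
def torsionProd {R : Type*} [CommRing R] (φ : MvPowerSeries (Fin n) k →+* R) :
    Submodule R ((p : minimalPrimes R) → Omega (branchMap φ p.1)) :=
  Submodule.pi Set.univ fun p => (torsionOmega (branchMap φ p.1)).restrictScalars R

end Differentials

end AlgebroidCurve

namespace AlgebroidCurve

section ReducedRings

variable {R : Type*} [CommRing R]

/-! For each minimal prime `p`, pick `s` outside `p` but in all other minimal primes; since `R` is
reduced, `s` annihilates `p`. By the Leibniz rule `s²` then kills the kernel of `Ω(R) → Ω(R/p)`
(`sq_smul_mem_relations`). If the image of `ω` is torsion, some `r ∉ p` kills it, so `t_p = s² r`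
kills `ω`. The sum of the `t_p` avoids every minimal prime, hence is a non-zero-divisor killing `ω`.
Conversely, a non-zero-divisor avoids all minimal primes, so it stays nonzero in each domain `R/p`.
-/

theorem eq_zero_of_forall_mem_minimalPrimes [IsReduced R] {x : R}
    (hx : ∀ p ∈ minimalPrimes R, x ∈ p) : x = 0 := by
  have h : x ∈ sInf (minimalPrimes R) := (Submodule.mem_sInf).2 hx
  rw [minimalPrimes, Ideal.sInf_minimalPrimes] at h
  exact (mem_nilradical.1 h).eq_zero

theorem mem_nonZeroDivisors_of_forall_notMem_minimalPrimes [IsReduced R] {x : R}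
    (hx : ∀ p ∈ minimalPrimes R, x ∉ p) : x ∈ nonZeroDivisors R := by
  refine mem_nonZeroDivisors_iff_right.2 fun y hy =>
    eq_zero_of_forall_mem_minimalPrimes fun p hp => ?_
  have : y * x ∈ p := hy ▸ p.zero_mem
  exact (hp.1.1.mem_or_mem this).resolve_right (hx p hp)

/-- Distinct minimal primes are incomparable: multiply elements of each `q ≠ p` lying outside `p`.
-/
theorem exists_notMem_minimalPrime_forall_mem_of_ne [Finite (minimalPrimes R)]
    (p : minimalPrimes R) :
    ∃ s : R, s ∉ p.1 ∧ ∀ q : minimalPrimes R, q ≠ p → s ∈ q.1 := by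
  classical
  have := Fintype.ofFinite (minimalPrimes R)
  have hpp : p.1.IsPrime := p.2.1.1
  have key : ∀ q : minimalPrimes R, ∃ x : R, x ∉ p.1 ∧ (q ≠ p → x ∈ q.1) := by
    intro q
    by_cases hqp : q = p
    · exact ⟨1, hpp.one_notMem, fun h => absurd hqp h⟩
    · have hle : ¬ q.1 ≤ p.1 := fun h =>
        hqp (Subtype.ext (le_antisymm h (p.2.2 q.2.1 h)))
      obtain ⟨x, hxq, hxp⟩ := SetLike.not_le_iff_exists.1 hle
      exact ⟨x, hxp, fun _ => hxq⟩
  choose x hxp hxq using key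
  refine ⟨∏ q, x q, fun h => ?_, fun q hq =>
    Ideal.mem_of_dvd _ (Finset.dvd_prod_of_mem x (Finset.mem_univ q)) (hxq q hq)⟩
  obtain ⟨q, -, hq⟩ := hpp.prod_mem_iff.1 h
  exact hxp q hq

end ReducedRings

section Torsion

variable {k : Type*} [Field k] {n : ℕ} {R : Type*} [CommRing R]
  {φ : MvPowerSeries (Fin n) k →+* R} {p : Ideal R}

theorem smul_eq_zero_of_mk_comp_eq_zero {s : R} (hs : ∀ x ∈ p, s * x = 0) {g : Fin n → R}
    (hg : (fun i => Ideal.Quotient.mk p (g i)) = 0) : s • g = 0 := by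
  ext i
  exact hs _ (Ideal.Quotient.eq_zero_iff_mem.1 (congrFun hg i))

/-- If `s` annihilates `p`, then `s²` brings lifts of relations of `R / p` to relations of `R`. -/
theorem sq_smul_mem_relations (hφ : Function.Surjective φ) {s : R}
    (hs : ∀ x ∈ p, s * x = 0) {v : Fin n → R ⧸ p} (hv : v ∈ relations (branchMap φ p)) :
    ∀ g : Fin n → R, (fun i => Ideal.Quotient.mk p (g i)) = v → (s * s) • g ∈ relations φ := by
  have hss : ∀ x ∈ p, s * s * x = 0 := fun x hx => by rw [mul_assoc, hs x hx, mul_zero]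
  -- Two lifts differ by a vector with entries in `p`, killed by `s²`, so one lift suffices.
  have lift : ∀ g g' : Fin n → R,
      (fun i => Ideal.Quotient.mk p (g i)) = (fun i => Ideal.Quotient.mk p (g' i)) →
      (s * s) • g' ∈ relations φ → (s * s) • g ∈ relations φ := by
    intro g g' hgg' hg'
    have h0 : (s * s) • (g - g') = 0 := by
      refine smul_eq_zero_of_mk_comp_eq_zero hss ?_
      ext i
      simpa [sub_eq_zero] using congrFun hgg' i
    rw [smul_sub, sub_eq_zero] at h0
    rwa [h0]
  have surj : ∀ w : Fin n → R ⧸ p, ∃ g : Fin n → R,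
      (fun i => Ideal.Quotient.mk p (g i)) = w := fun w =>
    ⟨fun i => (w i).out, funext fun i => Ideal.Quotient.mk_out (w i)⟩
  induction hv using Submodule.span_induction with
  | mem v hv =>
    obtain ⟨f, hf, rfl⟩ := hv
    intro g hg
    refine lift g (fun i => φ (MvPowerSeries.pderiv k i f)) hg ?_
    have hfp : φ f ∈ p := Ideal.Quotient.eq_zero_iff_mem.1 hf
    obtain ⟨S, rfl⟩ := hφ s
    have hmem : S * f ∈ RingHom.ker φ := by
      rw [RingHom.mem_ker, map_mul, hs _ hfp]
    have hgen : (fun i => φ (MvPowerSeries.pderiv k i (S * f))) ∈ relations φ :=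
      Submodule.subset_span ⟨S * f, hmem, rfl⟩
    -- `s · d(sf) = s² df + s f ds`, and `s f = 0` in `R`; hence the square.
    convert (relations φ).smul_mem (φ S) hgen using 1
    ext i
    simp only [Pi.smul_apply, smul_eq_mul, Derivation.leibniz, map_add, map_mul, mul_add]
    rw [← mul_assoc (φ S) (φ f), hs _ hfp, zero_mul, add_zero, mul_assoc]
  | zero =>
    intro g hg
    rw [smul_eq_zero_of_mk_comp_eq_zero hss hg]
    exact zero_mem _
  | add v w _ _ hv hw =>
    intro g hg
    obtain ⟨a, rfl⟩ := surj v
    obtain ⟨b, rfl⟩ := surj w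
    refine lift g (a + b) (hg.trans (funext fun i => by simp)) ?_
    rw [smul_add]
    exact add_mem (hv a rfl) (hw b rfl)
  | smul c v _ hv =>
    intro g hg
    obtain ⟨r, rfl⟩ := Ideal.Quotient.mk_surjective c
    obtain ⟨a, rfl⟩ := surj v
    refine lift g (r • a) (hg.trans (funext fun i => by simp)) ?_
    rw [smul_comm]
    exact (relations φ).smul_mem r (hv a rfl)

theorem sq_smul_eq_zero_of_toBranch_eq_zero (hφ : Function.Surjective φ) {s : R}
    (hs : ∀ x ∈ p, s * x = 0) {ω : Omega φ} (hω : toBranch φ p ω = 0) : (s * s) • ω = 0 := by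
  obtain ⟨g, rfl⟩ := Submodule.Quotient.mk_surjective _ ω
  rw [← Submodule.Quotient.mk_smul, Submodule.Quotient.mk_eq_zero]
  exact sq_smul_mem_relations hφ hs ((Submodule.Quotient.mk_eq_zero _).1 hω) g rfl

theorem mk_smul_eq_smul (r : R) (ω : Omega (branchMap φ p)) :
    Ideal.Quotient.mk p r • ω = r • ω :=
  algebraMap_smul (R ⧸ p) r ω

theorem toBranch_mem_torsionOmega_iff (hp : p.IsPrime) {ω : Omega φ} :
    toBranch φ p ω ∈ torsionOmega (branchMap φ p) ↔
      ∃ r : R, r ∉ p ∧ toBranch φ p (r • ω) = 0 := by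
  rw [Submodule.mem_torsion_iff]
  constructor
  · rintro ⟨⟨c, hc⟩, h⟩
    obtain ⟨r, rfl⟩ := Ideal.Quotient.mk_surjective c
    refine ⟨r, fun hr => nonZeroDivisors.ne_zero hc (Ideal.Quotient.eq_zero_iff_mem.2 hr), ?_⟩
    rw [map_smul, ← mk_smul_eq_smul]
    exact h
  · rintro ⟨r, hr, h⟩
    refine ⟨⟨Ideal.Quotient.mk p r, mem_nonZeroDivisors_of_ne_zero
      fun h0 => hr (Ideal.Quotient.eq_zero_iff_mem.1 h0)⟩, ?_⟩
    rw [map_smul, ← mk_smul_eq_smul] at h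
    exact h

theorem mem_torsionOmega_of_piStar_mem [IsReduced R] [Finite (minimalPrimes R)]
    (hφ : Function.Surjective φ) {ω : Omega φ} (hω : piStar φ ω ∈ torsionProd φ) :
    ω ∈ torsionOmega φ := by
  classical
  have := Fintype.ofFinite (minimalPrimes R)
  have key : ∀ p : minimalPrimes R, ∃ t : R, t ∉ p.1 ∧
      (∀ q : minimalPrimes R, q ≠ p → t ∈ q.1) ∧ t • ω = 0 := by
    intro p
    have hpp : p.1.IsPrime := p.2.1.1
    obtain ⟨r, hr, hrω⟩ := (toBranch_mem_torsionOmega_iff hpp).1 (hω p (Set.mem_univ p))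
    obtain ⟨s, hsp, hsq⟩ := exists_notMem_minimalPrime_forall_mem_of_ne p
    have hs : ∀ x ∈ p.1, s * x = 0 := fun x hx =>
      eq_zero_of_forall_mem_minimalPrimes fun q hq => by
        by_cases h : (⟨q, hq⟩ : minimalPrimes R) = p
        · subst h
          exact Ideal.mul_mem_left _ _ hx
        · exact Ideal.mul_mem_right _ _ (hsq _ h)
    refine ⟨s * s * r, hpp.mul_notMem (hpp.mul_notMem hsp hsp) hr, fun q hq =>
      Ideal.mul_mem_right _ _ (Ideal.mul_mem_right _ _ (hsq q hq)), ?_⟩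
    rw [mul_smul]
    exact sq_smul_eq_zero_of_toBranch_eq_zero hφ hs hrω
  choose t htp htq htω using key
  refine (Submodule.mem_torsion_iff _).2
    ⟨⟨∑ p, t p, mem_nonZeroDivisors_of_forall_notMem_minimalPrimes fun q hq h => ?_⟩, ?_⟩
  · refine htp ⟨q, hq⟩ ?_
    -- Modulo `q` only the term `t_q` of the sum survives.
    rw [← Finset.add_sum_erase _ t (Finset.mem_univ ⟨q, hq⟩)] at h
    exact (Ideal.add_mem_iff_left q (Ideal.sum_mem q fun p hp =>
      htq p ⟨q, hq⟩ (Finset.ne_of_mem_erase hp).symm)).1 h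
  · change (∑ p, t p) • ω = 0
    rw [Finset.sum_smul]
    exact Finset.sum_eq_zero fun p _ => htω p

theorem piStar_mem_torsionProd {ω : Omega φ} (hω : ω ∈ torsionOmega φ) :
    piStar φ ω ∈ torsionProd φ := by
  obtain ⟨⟨h, hh⟩, hhω⟩ := (Submodule.mem_torsion_iff _).1 hω
  intro p _
  refine (toBranch_mem_torsionOmega_iff p.2.1.1).2 ⟨h, fun hp =>
    notMem_nonZeroDivisors_of_mem_mem_minimalPrimes hp p.2 hh, ?_⟩
  change h • ω = 0 at hhω
  rw [hhω, map_zero]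

end Torsion

end AlgebroidCurve

theorem theorem4 {k : Type*} [Field k] [IsAlgClosed k] [CharZero k] (n : ℕ)
    (f : Fin (n - 1) → MvPowerSeries (Fin n) k)
    (A : Ideal (MvPowerSeries (Fin n) k)) (hA : A = Ideal.span (Set.range f))
    (hred : IsReduced (MvPowerSeries (Fin n) k ⧸ A))
    (hdim : ringKrullDim (MvPowerSeries (Fin n) k ⧸ A) = 1) :
    Submodule.comap (AlgebroidCurve.piStar (Ideal.Quotient.mk A))
        (AlgebroidCurve.torsionProd (Ideal.Quotient.mk A)) =
      AlgebroidCurve.torsionOmega (Ideal.Quotient.mk A) := by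
  have : Finite (minimalPrimes (MvPowerSeries (Fin n) k ⧸ A)) :=
    (minimalPrimes.finite_of_isNoetherianRing _).to_subtype
  ext ω
  exact ⟨AlgebroidCurve.mem_torsionOmega_of_piStar_mem Ideal.Quotient.mk_surjective,
    AlgebroidCurve.piStar_mem_torsionProd⟩
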